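/- Let $p\ge 1$. Consider infinite matrices $J=(a_{i,j})_{i,j\ge 0}$ with $a_{i,i+1}=1$, $a_{i,j}=0$ for $j>i+1$ and for $i>j+p$, where for each $j\ge 0$ the entries $a_{j,j},\dots,a_{j+p,j}$ of the $j$-th column are continuous complex-valued functions of $t$ on an open interval $I_j\subset\mathbb R$, and $\bigcap_{j=0}^{N} I_j\neq\emptyset$ for every $N$. Such a $J$ is called a solution of the full Kostant–Toda lattice (on the intervals $I_j$) if $$\dot a_{i,j}=(a_{i,i}-a_{j,j})a_{i,j}+a_{i+1,j}-a_{i,j-1},\qquad i,j=0,1,\dots$$ (with $a_{i,-1}=0$), each equation holding wherever all the columns occurring in it are defined. Similarly, continuous functions $\gamma_n:O_n\to\mathbb C$, $n\ge 1$, on open intervals $O_n$ any finitely many of which have a common point, form a solution of the discrete KdV equation if $$\dot\gamma_n=\gamma_n\Big(\sum_{i=1}^{p}\gamma_{n+i}-\sum_{i=1}^{p}\gamma_{n-i}\Big),\qquad n\ge 1,$$ wherever all the functions involved are defined, where $\gamma_m=0$ for $m\le 0$. Given a sequence $(\gamma_n)$, let $U$ be the upper bidiagonal matrix with diagonal $\gamma_1,\gamma_{p+2},\gamma_{2p+3},\dots$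 and all entries $1$ on the superdiagonal, and for $i=1,\dots,p$ let $L^{(i)}$ be the lower bidiagonal matrix with all entries $1$ on the diagonal and subdiagonal $\gamma_{i+1},\gamma_{p+i+2},\gamma_{2p+i+3},\dots$. Theorem. Let $J$ be a solution of the full Kostant–Toda lattice on the intervals $I_j$, with $a_{p+i,i}(t)\ne 0$ for all $i\ge 0$ and $t\in I_i$. Let $C\in\mathbb C$ be such that, for every $n$, the matrix $J_n$ of the first $n$ rows and columns of $J$ satisfies $\det(J_n(t)-CI_n)\neq 0$ for all $t\in\bigcap_{j<n}I_j$. Then there exist a solution $(\gamma_n)$ of the discrete KdV equation on some open intervals $O_n$, open intervals $K_j\subset I_j$ any finitely many of which have a common point, and $p$ solutions $J^{(1)},\dots,J^{(p)}$ of the full Kostant–Toda lattice on the intervals $K_j$ such that, with $J^{(0)}=J$, $$J^{(i)}=CI+L^{(i+1)}\cdots L^{(p)}\,U\,L^{(1)}\cdots L^{(i)},\qquad i=0,1,\dots,p,$$ where the equality of the $j$-th columns holds on $K_j$, and $K_j\subset O_n$ for all $1\le n\le (j+p+1)(p+1)$ (so that all the $\gamma_n$ that enter these columns are defined on $K_j$).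 -/

import Mathlib

namespace FullToda

/-- A sequence of open intervals of the real line (possibly unbounded), any finite number of
which have a common point. -/
def IntervalSystem (I : ℕ → Set ℝ) : Prop :=
  (∀ j, IsOpen (I j) ∧ (I j).OrdConnected) ∧ ∀ N : ℕ, (⋂ j ≤ N, I j).Nonempty

/-- The solutions of the full Kostant-Toda lattice. `J t i j` is the entry in row `i` and
column `j` at time `t`; column `j` is considered on the interval `I j` only. Each equation is
required wherever all the columns occurring in it are defined, and entries with column
index `-1` are zero. -/
structure IsTodaSolution (p : ℕ) (I : ℕ → Set ℝ) (J : ℝ → Matrix ℕ ℕ ℂ) : Prop where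
  intervals : IntervalSystem I
  superdiag : ∀ i, ∀ t ∈ I (i + 1), J t i (i + 1) = 1
  upper : ∀ i j, i + 1 < j → ∀ t ∈ I j, J t i j = 0
  lower : ∀ i j, j + p < i → ∀ t ∈ I j, J t i j = 0
  continuousOn : ∀ i j, j ≤ i → i ≤ j + p → ContinuousOn (fun t => J t i j) (I j)
  ode : ∀ i j, ∀ t, t ∈ I i → t ∈ I j → t ∈ I (j - 1) →
    HasDerivAt (fun s => J s i j)
      ((J t i i - J t j j) * J t i j + J t (i + 1) j - (if j = 0 then 0 else J t i (j - 1))) t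

/-- The solutions `γ 1, γ 2, ...` of the discrete Korteweg-de Vries equation, where
`γ n` is considered on the interval `O n` only, and `γ m` is read as zero for `m ≤ 0`.
The value `γ 0` is not used. -/
structure IsKdVSolution (p : ℕ) (O : ℕ → Set ℝ) (γ : ℕ → ℝ → ℂ) : Prop where
  intervals : IntervalSystem O
  continuousOn : ∀ n, 1 ≤ n → ContinuousOn (γ n) (O n)
  ode : ∀ n, 1 ≤ n → ∀ t, (∀ m, 1 ≤ m → n ≤ m + p → m ≤ n + p → t ∈ O m) →
    HasDerivAt (γ n)
      (γ n t * (∑ i ∈ Finset.Icc 1 p, γ (n + i) t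
        - ∑ i ∈ Finset.Icc 1 p, if i < n then γ (n - i) t else 0)) t

/-- The block formed by the first `n` rows and columns of an infinite matrix. -/
def leadingBlock (M : Matrix ℕ ℕ ℂ) (n : ℕ) : Matrix (Fin n) (Fin n) ℂ :=
  M.submatrix (fun i => (i : ℕ)) (fun i => (i : ℕ))

/-- The product of two infinite matrices, the first of which has finitely many nonzero entries in
each row (this is so for all the products below). -/
noncomputable def mul (A B : Matrix ℕ ℕ ℂ) : Matrix ℕ ℕ ℂ :=
  Matrix.of fun i j => ∑ᶠ k, A i k * B k j

/-- The product of a finite list of infinite matrices, in the order of the list. -/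
noncomputable def prod (l : List (Matrix ℕ ℕ ℂ)) : Matrix ℕ ℕ ℂ :=
  l.foldr mul 1

/-- The upper bidiagonal factor: diagonal `g 1, g (p + 2), g (2 p + 3), ...`, ones above it. -/
def U (p : ℕ) (g : ℕ → ℂ) : Matrix ℕ ℕ ℂ :=
  Matrix.of fun r c => if c = r then g (r * p + r + 1) else if c = r + 1 then 1 else 0

/-- The `i`-th lower bidiagonal factor: ones on the diagonal, and
`g (i + 1), g (p + i + 2), g (2 p + i + 3), ...` below it. -/
def L (p : ℕ) (g : ℕ → ℂ) (i : ℕ) : Matrix ℕ ℕ ℂ :=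
  Matrix.of fun r c => if r = c then 1 else if r = c + 1 then g (c * p + c + i + 1) else 0

/-- The circular permutation `L⁽ⁱ⁺¹⁾ ⋯ L⁽ᵖ⁾ U L⁽¹⁾ ⋯ L⁽ⁱ⁾`, for `0 ≤ i ≤ p`. -/
noncomputable def circular (p : ℕ) (g : ℕ → ℂ) (i : ℕ) : Matrix ℕ ℕ ℂ :=
  prod ((List.range' (i + 1) (p - i)).map (L p g) ++ [U p g] ++ (List.range' 1 i).map (L p g))

end FullToda

namespace FullToda

open Filter Topology MeasureTheory

/-- A proper filter on the real line with a basis of open intervals. -/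
structure IsIntervalFilter (F : Filter ℝ) : Prop where
  neBot : F.NeBot
  exists_interval : ∀ s ∈ F, ∃ V ∈ F, V ⊆ s ∧ IsOpen V ∧ V.OrdConnected

theorem IntervalSystem.exists_filter {I : ℕ → Set ℝ} (hI : IntervalSystem I) :
    ∃ F : Filter ℝ, IsIntervalFilter F ∧ ∀ j, I j ∈ F := by
  have hdir : Directed (· ≥ ·) fun N : ℕ => ⋂ j ≤ N, I j := by
    refine Antitone.directed_ge fun a b hab => ?_
    exact Set.biInter_subset_biInter_left fun j (hj : j ≤ a) => le_trans hj hab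
  have hb := hasBasis_iInf_principal hdir
  refine ⟨⨅ N : ℕ, 𝓟 (⋂ j ≤ N, I j), ⟨?_, ?_⟩, fun j => ?_⟩
  · exact hb.neBot_iff.2 fun {N} _ => hI.2 N
  · intro s hs
    obtain ⟨N, -, hN⟩ := hb.mem_iff.1 hs
    refine ⟨_, hb.mem_of_mem (i := N) trivial, hN, ?_, ?_⟩
    · exact (Set.finite_Iic N).isOpen_biInter fun j _ => (hI.1 j).1
    · exact Set.ordConnected_biInter fun j _ => (hI.1 j).2
  · exact hb.mem_iff.2 ⟨j, trivial, Set.biInter_subset_of_mem (le_refl j)⟩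

theorem IsIntervalFilter.intervalSystem {F : Filter ℝ} (hF : IsIntervalFilter F)
    {O : ℕ → Set ℝ} (hO : ∀ n, O n ∈ F ∧ IsOpen (O n) ∧ (O n).OrdConnected) :
    IntervalSystem O := by
  refine ⟨fun j => (hO j).2, fun N => ?_⟩
  have := hF.neBot
  refine nonempty_of_mem (f := F) ?_
  exact (biInter_mem (Set.finite_Iic N)).2 fun j _ => (hO j).1

theorem IsIntervalFilter.exists_primitive {F : Filter ℝ} (hF : IsIntervalFilter F) {f : ℝ → ℂ}
    (hf : ∀ᶠ t in F, ContinuousAt f t) : ∃ P : ℝ → ℂ, ∀ᶠ t in F, HasDerivAt P (f t) t := by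
  obtain ⟨V, hVF, hVs, hVo, hVc⟩ := hF.exists_interval _ hf
  have := hF.neBot
  obtain ⟨a, ha⟩ := nonempty_of_mem hVF
  have hcont : ContinuousOn f V := fun t ht => (hVs ht).continuousWithinAt
  refine ⟨fun t => ∫ s in a..t, f s, mem_of_superset hVF fun t ht => ?_⟩
  exact intervalIntegral.integral_hasDerivAt_right
    ((hcont.mono (hVc.uIcc_subset ha ht)).intervalIntegrable)
    (hcont.stronglyMeasurableAtFilter hVo t ht) (hVs ht)

theorem IsIntervalFilter.exists_exp {F : Filter ℝ} (hF : IsIntervalFilter F) {a : ℝ → ℂ}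
    (ha : ∀ᶠ t in F, ContinuousAt a t) :
    ∃ y : ℝ → ℂ, (∀ t, y t ≠ 0) ∧ ∀ᶠ t in F, HasDerivAt y (a t * y t) t := by
  obtain ⟨A, hA⟩ := hF.exists_primitive ha
  refine ⟨fun t => Complex.exp (A t), fun t => Complex.exp_ne_zero _, ?_⟩
  filter_upwards [hA] with t ht
  simpa [mul_comm] using ht.cexp

theorem IsIntervalFilter.exists_linear_solution {F : Filter ℝ} (hF : IsIntervalFilter F)
    {a f : ℝ → ℂ} (ha : ∀ᶠ t in F, ContinuousAt a t) (hf : ∀ᶠ t in F, ContinuousAt f t) :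
    ∃ y : ℝ → ℂ, ∀ᶠ t in F, HasDerivAt y (a t * y t + f t) t := by
  obtain ⟨e, he0, he⟩ := hF.exists_exp ha
  obtain ⟨P, hP⟩ := hF.exists_primitive (f := fun t => f t / e t) (by
    filter_upwards [hf, he] with t h1 h2
    exact h1.div h2.continuousAt (he0 t))
  refine ⟨fun t => e t * P t, ?_⟩
  filter_upwards [he, hP] with t h1 h2
  refine (h1.mul h2).congr_deriv ?_
  rw [mul_div_cancel₀ _ (he0 t)]
  ring

/-- The value preceding `f n`, zero for `n = 0`. -/
def prev (f : ℕ → ℂ) (n : ℕ) : ℂ := if n = 0 then 0 else f (n - 1)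

@[simp] theorem prev_zero (f : ℕ → ℂ) : prev f 0 = 0 := rfl

@[simp] theorem prev_succ (f : ℕ → ℂ) (n : ℕ) : prev f (n + 1) = f n := rfl

/-- A triangular fundamental system for `y' = - y (diag q + shift)`. -/
theorem IsIntervalFilter.exists_fundamental {F : Filter ℝ} (hF : IsIntervalFilter F)
    {q : ℕ → ℝ → ℂ} (hq : ∀ n, ∀ᶠ t in F, ContinuousAt (q n) t) :
    ∃ z : ℕ → ℕ → ℝ → ℂ,
      (∀ i j, ∀ᶠ t in F,
        HasDerivAt (z i j) (-(q j t * z i j t + prev (fun k => z i k t) j)) t) ∧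
      (∀ i j t, j < i → z i j t = 0) ∧ ∀ i t, z i i t ≠ 0 := by
  have hexp : ∀ j, ∃ y : ℝ → ℂ, (∀ t, y t ≠ 0) ∧ ∀ᶠ t in F, HasDerivAt y (-q j t * y t) t :=
    fun j => hF.exists_exp ((hq j).mono fun t ht => ht.neg)
  choose e he0 he using hexp
  have hsol : ∀ (j : ℕ) (f : ℝ → ℂ), ∃ y : ℝ → ℂ, (∀ᶠ t in F, ContinuousAt f t) →
      ∀ᶠ t in F, HasDerivAt y (-q j t * y t + -f t) t := by
    intro j f
    by_cases hf : ∀ᶠ t in F, ContinuousAt f t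
    · obtain ⟨y, hy⟩ := hF.exists_linear_solution (a := fun t => -q j t) (f := fun t => -f t)
        ((hq j).mono fun t ht => ht.neg) (hf.mono fun t ht => ht.neg)
      exact ⟨y, fun _ => hy⟩
    · exact ⟨0, fun h => absurd h hf⟩
  choose S hS using hsol
  let z : ℕ → ℕ → ℝ → ℂ := fun i j => Nat.rec (if i = 0 then e 0 else 0)
    (fun k y => if k + 1 < i then 0 else if k + 1 = i then e (k + 1) else S (k + 1) y) j
  have hz0 : ∀ i, z i 0 = if i = 0 then e 0 else 0 := fun i => rfl
  have hz1 : ∀ i k, z i (k + 1) =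
    if k + 1 < i then 0 else if k + 1 = i then e (k + 1) else S (k + 1) (z i k) :=
    fun i k => rfl
  have hlow : ∀ i j t, j < i → z i j t = 0 := by
    intro i j t hij
    cases j with
    | zero => rw [hz0, if_neg (by omega)]; rfl
    | succ k => rw [hz1, if_pos hij]; rfl
  have hlow' : ∀ i j, j < i → z i j = 0 := fun i j hij => funext fun t => hlow i j t hij
  refine ⟨z, ?_, hlow, ?_⟩
  · intro i j
    induction j with
    | zero =>
      by_cases hi : i = 0
      · rw [hz0, if_pos hi]
        filter_upwards [he 0] with t ht
        simpa using ht
      · rw [hz0, if_neg hi]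
        refine Eventually.of_forall fun t => ?_
        simp
    | succ k ih =>
      simp only [prev_succ]
      by_cases h1 : k + 1 < i
      · rw [hlow' i _ h1, hlow' i k (by omega)]
        refine Eventually.of_forall fun t => ?_
        simp
      by_cases h2 : k + 1 = i
      · rw [hz1, if_neg h1, if_pos h2, hlow' i k (by omega)]
        filter_upwards [he (k + 1)] with t ht
        simpa using ht
      · rw [hz1, if_neg h1, if_neg h2]
        filter_upwards [hS (k + 1) (z i k) (ih.mono fun t ht => ht.continuousAt)] with t ht
        exact ht.congr_deriv (by ring)
  · intro i t
    cases i with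
    | zero => rw [hz0, if_pos rfl]; exact he0 0 t
    | succ k => rw [hz1, if_neg (by omega), if_pos rfl]; exact he0 _ t

theorem volume_image_real_eq_zero {T : Set ℝ} {f : ℝ → ℂ}
    (hf : ∀ t ∈ T, DifferentiableAt ℝ f t) : volume (f '' T) = 0 := by
  have himg : f '' T = (fun z : ℂ => f z.re) '' ((fun x : ℝ => (x : ℂ)) '' T) := by
    rw [Set.image_image]; simp
  rw [himg]
  apply addHaar_image_eq_zero_of_differentiableOn_of_addHaar_eq_zero (E := ℂ)
  · rintro _ ⟨t, ht, rfl⟩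
    apply DifferentiableAt.differentiableWithinAt
    have h1 : DifferentiableAt ℝ f (Complex.reCLM (t : ℂ)) := by simpa using hf t ht
    exact h1.comp (t : ℂ) Complex.reCLM.differentiableAt
  · have hle : (fun x : ℝ => (x : ℂ)) '' T ⊆ (LinearMap.range Complex.ofRealCLM.toLinearMap : Set ℂ) := by
      rintro _ ⟨t, -, rfl⟩
      exact ⟨t, rfl⟩
    refine measure_mono_null hle (Measure.addHaar_submodule volume _ ?_)
    intro h
    have : Complex.I ∈ LinearMap.range Complex.ofRealCLM.toLinearMap := by rw [h]; trivial
    obtain ⟨x, hx⟩ := this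
    have := congrArg Complex.im hx
    simp at this

theorem exists_forall_ne {T : ℕ → Set ℝ} {f : ℕ → ℝ → ℂ}
    (hf : ∀ n, ∀ t ∈ T n, DifferentiableAt ℝ (f n) t) : ∃ s : ℂ, ∀ n, ∀ t ∈ T n, f n t ≠ s := by
  have h0 : volume (⋃ n, f n '' T n) = 0 :=
    measure_iUnion_null fun n => volume_image_real_eq_zero (hf n)
  have hne : (⋃ n, f n '' T n) ≠ Set.univ := by
    intro h
    rw [h] at h0
    simp at h0
  obtain ⟨s, hs⟩ := (Set.ne_univ_iff_exists_notMem _).1 hne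
  exact ⟨s, fun n t ht h => hs (Set.mem_iUnion.2 ⟨n, t, ht, h⟩)⟩

/-- Countably many differentiable curves of nonzero linear forms on a complex vector space have a
common vector at which none of the forms vanishes. -/
theorem exists_generic_vector (b : ℕ) : ∀ (T : ℕ → Set ℝ) (v : ℕ → ℕ → ℝ → ℂ),
    (∀ n, ∀ i < b, ∀ t ∈ T n, DifferentiableAt ℝ (v n i) t) →
    (∀ n, ∀ t ∈ T n, ∃ i < b, v n i t ≠ 0) →
    ∃ c : ℕ → ℂ, ∀ n, ∀ t ∈ T n, ∑ i ∈ Finset.range b, c i * v n i t ≠ 0 := by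
  induction b with
  | zero =>
    intro T v _ h
    refine ⟨0, fun n t ht => ?_⟩
    obtain ⟨i, hi, -⟩ := h n t ht
    omega
  | succ b ih =>
    intro T v hd h
    obtain ⟨c, hc⟩ := ih (fun n => {t ∈ T n | ∃ i < b, v n i t ≠ 0}) v
      (fun n i hi t ht => hd n i (by omega) t ht.1) (fun n t ht => ht.2)
    obtain ⟨s, hs⟩ := exists_forall_ne (T := fun n => {t ∈ T n | v n b t ≠ 0})
      (f := fun n t => -(∑ i ∈ Finset.range b, c i * v n i t) / v n b t) (by
        rintro n t ⟨ht, hb⟩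
        refine DifferentiableAt.div (DifferentiableAt.neg ?_) (hd n b (by omega) t ht) hb
        refine DifferentiableAt.fun_sum fun i hi => ?_
        exact (hd n i (by have := Finset.mem_range.1 hi; omega) t ht).const_mul _)
    refine ⟨Function.update c b s, fun n t ht => ?_⟩
    have hsum : ∑ i ∈ Finset.range b, Function.update c b s i * v n i t
        = ∑ i ∈ Finset.range b, c i * v n i t := by
      refine Finset.sum_congr rfl fun i hi => ?_
      rw [Function.update_of_ne (by have := Finset.mem_range.1 hi; omega)]
    rw [Finset.sum_range_succ, hsum, Function.update_self]
    by_cases hb : v n b t = 0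
    · rw [hb, mul_zero, add_zero]
      refine hc n t ⟨ht, ?_⟩
      obtain ⟨i, hi, hi'⟩ := h n t ht
      refine ⟨i, ?_, hi'⟩
      rcases Nat.lt_succ_iff_lt_or_eq.1 hi with h1 | h1
      · exact h1
      · exact absurd (h1 ▸ hb) hi'
    · intro h0
      refine hs n t ⟨ht, hb⟩ ?_
      rw [div_eq_iff hb]
      linear_combination -h0

theorem eventually_forall_le {F : Filter ℝ} {p : ℕ → ℝ → Prop} (h : ∀ k, ∀ᶠ t in F, p k t)
    (n : ℕ) : ∀ᶠ t in F, ∀ k ≤ n, p k t :=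
  (eventually_all_finite (Set.finite_Iic n)).2 fun k _ => h k

/-- The left null vector with initial entries `z 0, ..., z (b - 1)` of a matrix with `b` lower
diagonals. -/
noncomputable def nullVec (b : ℕ) (z : ℕ → ℂ) (M : ℕ → ℕ → ℂ) (n : ℕ) : ℂ :=
  if n < b then z n else -(∑ k : Fin n, nullVec b z M k * M k (n - b)) / M n (n - b)
termination_by n
decreasing_by exact k.2

theorem nullVec_of_lt {b : ℕ} {z : ℕ → ℂ} {M : ℕ → ℕ → ℂ} {n : ℕ} (h : n < b) :
    nullVec b z M n = z n := by
  rw [nullVec, if_pos h]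

theorem nullVec_add (b : ℕ) (z : ℕ → ℂ) (M : ℕ → ℕ → ℂ) (c : ℕ) :
    nullVec b z M (c + b) =
      -(∑ k ∈ Finset.range (c + b), nullVec b z M k * M k c) / M (c + b) c := by
  rw [nullVec, if_neg (by omega), Nat.add_sub_cancel,
    Finset.sum_range fun k => nullVec b z M k * M k c]

theorem sum_nullVec {b : ℕ} {z : ℕ → ℂ} {M : ℕ → ℕ → ℂ} {c : ℕ} (h : M (c + b) c ≠ 0) :
    ∑ k ∈ Finset.range (c + b + 1), nullVec b z M k * M k c = 0 := by
  rw [Finset.sum_range_succ, nullVec_add, div_mul_cancel₀ _ h, add_neg_cancel]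

theorem eq_zero_of_null {b n : ℕ} {M : ℕ → ℕ → ℂ} {d : ℕ → ℂ} (h0 : ∀ j < b, d j = 0)
    (hM : ∀ c, c + b ≤ n → M (c + b) c ≠ 0)
    (hd : ∀ c, c + b ≤ n → ∑ k ∈ Finset.range (c + b + 1), d k * M k c = 0) :
    ∀ j ≤ n, d j = 0 := by
  intro j
  induction j using Nat.strong_induction_on with
  | _ j ih =>
    intro hj
    by_cases hb : j < b
    · exact h0 j hb
    obtain ⟨c, rfl⟩ : ∃ c, j = c + b := ⟨j - b, by omega⟩
    have h := hd c hj
    rw [Finset.sum_range_succ, Finset.sum_eq_zero, zero_add] at h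
    · exact (mul_eq_zero.1 h).resolve_right (hM c hj)
    · intro k hk
      have hk := Finset.mem_range.1 hk
      rw [ih k hk (by omega), zero_mul]

/-- If the leading block of order `n` is invertible, the entry of index `n` is not identically zero
on the space of left null vectors. -/
theorem exists_nullVec_ne_zero {b n : ℕ} {M : ℕ → ℕ → ℂ} {z : ℕ → ℕ → ℂ} (hb : 1 ≤ b)
    (hlow : ∀ r c, r ≤ n → c + b < r → M r c = 0) (hout : ∀ c ≤ n, M (c + b) c ≠ 0)
    (hdet : (Matrix.of fun i j : Fin n => M i j).det ≠ 0)
    (hz : ∀ i j, j < i → z i j = 0) (hz' : ∀ i, z i i ≠ 0) :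
    ∃ i < b, nullVec b (z i) M n ≠ 0 := by
  by_cases hn : n < b
  · exact ⟨n, hn, by rw [nullVec_of_lt hn]; exact hz' n⟩
  by_contra! hv
  set A : Matrix (Fin n) (Fin n) ℂ := Matrix.of fun i j : Fin n => M i j with hA
  have hAu : IsUnit A.det := isUnit_iff_ne_zero.2 hdet
  let w : Fin n → ℂ := Matrix.vecMul (fun j : Fin n => -M n j) A⁻¹
  have hw : Matrix.vecMul w A = fun j : Fin n => -M n j := by
    rw [Matrix.vecMul_vecMul, Matrix.nonsing_inv_mul _ hAu, Matrix.vecMul_one]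
  let η : ℕ → ℂ := fun k => if h : k < n then w ⟨k, h⟩ else 1
  have hηn : η n = 1 := dif_neg (lt_irrefl n)
  have hη : ∀ c, c + b ≤ n → ∑ k ∈ Finset.range (c + b + 1), η k * M k c = 0 := by
    intro c hc
    have h1 : ∑ k ∈ Finset.range (c + b + 1), η k * M k c
        = ∑ k ∈ Finset.range (n + 1), η k * M k c := by
      refine Finset.sum_subset (Finset.range_subset_range.2 (by omega)) fun k hk hk' => ?_
      rw [Finset.mem_range] at hk hk'
      rw [hlow k c (by omega) (by omega), mul_zero]
    have h2 := congrFun hw ⟨c, by omega⟩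
    simp only [Matrix.vecMul, dotProduct, hA, Matrix.of_apply] at h2
    rw [h1, Finset.sum_range_succ, hηn, Finset.sum_range fun k => η k * M k c, one_mul]
    rw [← sub_eq_zero] at h2
    rw [← h2, sub_neg_eq_add]
    congr 1
    refine Finset.sum_congr rfl fun k _ => ?_
    simp [η]
  set Z : Matrix (Fin b) (Fin b) ℂ := Matrix.of fun i j : Fin b => z i j with hZ
  have hZu : IsUnit Z.det := by
    rw [isUnit_iff_ne_zero, Matrix.det_of_isUpperTriangular]
    · exact Finset.prod_ne_zero_iff.2 fun i _ => hz' i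
    · intro i j hij
      exact hz i j hij
  let a : Fin b → ℂ := Matrix.vecMul (fun j : Fin b => η j) Z⁻¹
  have ha : Matrix.vecMul a Z = fun j : Fin b => η j := by
    rw [Matrix.vecMul_vecMul, Matrix.nonsing_inv_mul _ hZu, Matrix.vecMul_one]
  have hd := eq_zero_of_null (b := b) (n := n) (M := M)
    (d := fun k => η k - ∑ i : Fin b, a i * nullVec b (z i) M k) ?_ ?_ ?_ n le_rfl
  · rw [hηn, Finset.sum_eq_zero, sub_zero] at hd
    · exact one_ne_zero hd
    · intro i _
      rw [hv i i.2, mul_zero]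
  · intro j hj
    have h2 := congrFun ha ⟨j, hj⟩
    simp only [Matrix.vecMul, dotProduct, hZ, Matrix.of_apply] at h2
    rw [sub_eq_zero, ← h2]
    refine Finset.sum_congr rfl fun i _ => ?_
    rw [nullVec_of_lt hj]
  · intro c hc
    exact hout c (by omega)
  · intro c hc
    simp only [sub_mul, Finset.sum_sub_distrib, hη c hc, zero_sub, neg_eq_zero, Finset.sum_mul]
    rw [Finset.sum_comm]
    refine Finset.sum_eq_zero fun i _ => ?_
    simp only [mul_assoc]
    rw [← Finset.mul_sum, sum_nullVec (hout c (by omega)), mul_zero]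

/-- The right-hand side of `M' = (diag q + shift) M - M (diag P + shift)`. -/
def laxRhs (q P : ℕ → ℂ) (M : ℕ → ℕ → ℂ) (r c : ℕ) : ℂ :=
  q r * M r c + M (r + 1) c - M r c * P c - prev (M r) c

theorem sum_laxRhs (q P y : ℕ → ℂ) (M : ℕ → ℕ → ℂ) (c N : ℕ) :
    ∑ k ∈ Finset.range (N + 1),
        (-(q k * y k + prev y k) * M k c + y k * laxRhs q P M k c)
      = y N * M (N + 1) c - P c * ∑ k ∈ Finset.range (N + 1), y k * M k c
        - ∑ k ∈ Finset.range (N + 1), y k * prev (M k) c := by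
  induction N with
  | zero => simp [laxRhs]; ring
  | succ N ih =>
    rw [Finset.sum_range_succ, ih, Finset.sum_range_succ (fun k => y k * M k c) (N + 1),
      Finset.sum_range_succ (fun k => y k * prev (M k) c) (N + 1)]
    simp only [laxRhs, prev_succ]
    ring

/-- A banded matrix of functions with `b` lower diagonals, the superdiagonal being `1`, that
satisfies `M' = (diag q + shift) M - M (diag P + shift)`, every condition holding eventually
along `F`. -/
structure IsLaxFlow (F : Filter ℝ) (b : ℕ) (q P : ℕ → ℝ → ℂ) (M : ℕ → ℕ → ℝ → ℂ) : Prop where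
  continuousAt : ∀ r, ∀ᶠ t in F, ContinuousAt (q r) t
  ode : ∀ r c, ∀ᶠ t in F, HasDerivAt (M r c)
    (laxRhs (fun k => q k t) (fun k => P k t) (fun i j => M i j t) r c) t
  superdiag : ∀ r, ∀ᶠ t in F, M r (r + 1) t = 1
  upper : ∀ r c, r + 1 < c → ∀ᶠ t in F, M r c t = 0
  lower : ∀ r c, c + b < r → ∀ᶠ t in F, M r c t = 0
  outer : ∀ c, ∀ᶠ t in F, M (c + b) c t ≠ 0
  det_ne_zero : ∀ n, ∀ᶠ t in F, (Matrix.of fun i j : Fin n => M i j t).det ≠ 0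

theorem IsLaxFlow.hasDerivAt_nullVec {F : Filter ℝ} {b : ℕ} {q P : ℕ → ℝ → ℂ}
    {M : ℕ → ℕ → ℝ → ℂ} (h : IsLaxFlow F b q P M) {z : ℕ → ℝ → ℂ}
    (hz : ∀ j, ∀ᶠ t in F, HasDerivAt (z j) (-(q j t * z j t + prev (fun k => z k t) j)) t)
    (n : ℕ) :
    ∀ᶠ t in F, HasDerivAt (fun s => nullVec b (fun k => z k s) (fun i j => M i j s) n)
      (-(q n t * nullVec b (fun k => z k t) (fun i j => M i j t) n
        + prev (nullVec b (fun k => z k t) (fun i j => M i j t)) n)) t := by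
  induction n using Nat.strong_induction_on with
  | _ n ih =>
    by_cases hn : n < b
    · filter_upwards [hz n] with t ht
      simp only [nullVec_of_lt hn]
      refine ht.congr_deriv ?_
      congr 2
      cases n with
      | zero => rfl
      | succ n => simp only [prev_succ]; rw [nullVec_of_lt (by omega)]
    obtain ⟨c, rfl⟩ : ∃ c, n = c + b := ⟨n - b, by omega⟩
    have hall : ∀ᶠ t in F, ∀ k < c + b, HasDerivAt
        (fun s => nullVec b (fun k => z k s) (fun i j => M i j s) k)
        (-(q k t * nullVec b (fun k => z k t) (fun i j => M i j t) k
          + prev (nullVec b (fun k => z k t) (fun i j => M i j t)) k)) t :=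
      (eventually_all_finite (Set.finite_Iio (c + b))).2 fun k hk => ih k hk
    have hpred : ∀ᶠ t in F, c ≠ 0 → M (c - 1 + b) (c - 1) t ≠ 0 ∧ M (c + b) (c - 1) t = 0 := by
      by_cases hc : c = 0
      · simp [hc]
      · filter_upwards [h.outer (c - 1), h.lower (c + b) (c - 1) (by omega)] with t h1 h2 _
        exact ⟨h1, h2⟩
    filter_upwards [hall, hpred, h.outer c, h.lower (c + b + 1) c (by omega),
      eventually_forall_le (fun k => h.ode k c) (c + b)] with t hy hp ho hl hM
    simp only [nullVec_add b _ _ c]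
    set y := nullVec b (fun k => z k t) (fun i j => M i j t) with hydef
    have hS : HasDerivAt (fun s => ∑ k ∈ Finset.range (c + b),
        nullVec b (fun k => z k s) (fun i j => M i j s) k * M k c s) _ t :=
      HasDerivAt.fun_sum fun k hk => (hy k (Finset.mem_range.1 hk)).mul
        (hM k (Finset.mem_range.1 hk).le)
    refine (hS.neg.div (hM (c + b) le_rfl) ho).congr_deriv ?_
    have hnull : ∑ k ∈ Finset.range (c + b + 1), y k * M k c t = 0 :=
      sum_nullVec (M := fun i j => M i j t) ho
    have hprev : ∑ k ∈ Finset.range (c + b + 1), y k * prev (fun j => M k j t) c = 0 := by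
      rcases Nat.eq_zero_or_pos c with hc | hc
      · subst hc; simp
      · obtain ⟨h1, h2⟩ := hp hc.ne'
        obtain ⟨d, rfl⟩ : ∃ d, c = d + 1 := ⟨c - 1, by omega⟩
        simp only [prev_succ, Nat.add_sub_cancel] at h1 h2 ⊢
        rw [Finset.sum_range_succ, h2, mul_zero, add_zero, Nat.add_right_comm d 1 b]
        exact sum_nullVec (M := fun i j => M i j t) h1
    have key := sum_laxRhs (fun k => q k t) (fun k => P k t) y (fun i j => M i j t) c (c + b)
    rw [hnull, hprev, hl, Finset.sum_range_succ] at key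
    have hyn : y (c + b) * M (c + b) c t
        = -(∑ k ∈ Finset.range (c + b), y k * M k c t) := by
      rw [Finset.sum_range_succ] at hnull
      linear_combination hnull
    have hyn' : -(∑ k ∈ Finset.range (c + b), y k * M k c t) / M (c + b) c t = y (c + b) := by
      rw [← hyn, mul_div_cancel_right₀ _ ho]
    rw [hyn', eq_comm, eq_div_iff (pow_ne_zero 2 ho)]
    simp only [Pi.neg_apply]
    rw [← hydef, ← hyn]
    linear_combination (M (c + b) c t) * key

theorem IsLaxFlow.exists_left_null {F : Filter ℝ} (hF : IsIntervalFilter F) {b : ℕ}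
    {q P : ℕ → ℝ → ℂ} {M : ℕ → ℕ → ℝ → ℂ} (h : IsLaxFlow F b q P M) (hb : 1 ≤ b) :
    ∃ y : ℕ → ℝ → ℂ, (∀ n, ∀ᶠ t in F, y n t ≠ 0) ∧
      (∀ n, ∀ᶠ t in F,
        HasDerivAt (y n) (-(q n t * y n t + prev (fun k => y k t) n)) t) ∧
      ∀ c, ∀ᶠ t in F, ∑ k ∈ Finset.range (c + b + 1), y k t * M k c t = 0 := by
  obtain ⟨z, hz, hz0, hz1⟩ := hF.exists_fundamental h.continuousAt
  let v : ℕ → ℕ → ℝ → ℂ := fun n i t => nullVec b (fun k => z i k t) (fun i j => M i j t) n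
  have hv : ∀ i n, ∀ᶠ t in F,
      HasDerivAt (v n i) (-(q n t * v n i t + prev (fun k => v k i t) n)) t :=
    fun i n => h.hasDerivAt_nullVec (hz i) n
  have hv0 : ∀ n, ∀ᶠ t in F, ∃ i < b, v n i t ≠ 0 := by
    intro n
    have hlow : ∀ᶠ t in F, ∀ r ≤ n, ∀ c ≤ n, c + b < r → M r c t = 0 := by
      refine eventually_forall_le (fun r => eventually_forall_le (fun c => ?_) n) n
      by_cases hc : c + b < r
      · exact (h.lower r c hc).mono fun t ht _ => ht
      · exact Eventually.of_forall fun t h' => absurd h' hc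
    filter_upwards [hlow, eventually_forall_le h.outer n, h.det_ne_zero n] with t h1 h2 h3
    exact exists_nullVec_ne_zero (M := fun i j => M i j t) (z := fun i k => z i k t) hb
      (fun r c hr hc => h1 r hr c (by omega) hc) h2 h3 (fun i j hij => hz0 i j t hij)
      (fun i => hz1 i t)
  obtain ⟨c, hc⟩ := exists_generic_vector b
    (fun n => {t | (∀ i < b, DifferentiableAt ℝ (v n i) t) ∧ ∃ i < b, v n i t ≠ 0}) v
    (fun n i hi t ht => ht.1 i hi) (fun n t ht => ht.2)
  refine ⟨fun n t => ∑ i ∈ Finset.range b, c i * v n i t, fun n => ?_, fun n => ?_, fun k => ?_⟩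
  · filter_upwards [hv0 n, eventually_forall_le (fun i => hv i n) b] with t h1 h2
    exact hc n t ⟨fun i hi => (h2 i hi.le).differentiableAt, h1⟩
  · filter_upwards [eventually_forall_le (fun i => hv i n) b] with t h2
    refine (HasDerivAt.fun_sum fun i hi =>
      (h2 i (Finset.mem_range.1 hi).le).const_mul (c i)).congr_deriv ?_
    have hp : prev (fun k => ∑ i ∈ Finset.range b, c i * v k i t) n
        = ∑ i ∈ Finset.range b, c i * prev (fun k => v k i t) n := by
      cases n <;> simp
    rw [hp, Finset.mul_sum, ← Finset.sum_add_distrib, ← Finset.sum_neg_distrib]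
    exact Finset.sum_congr rfl fun i _ => by ring
  · filter_upwards [h.outer k] with t h1
    simp only [Finset.sum_mul]
    rw [Finset.sum_comm]
    refine Finset.sum_eq_zero fun i _ => ?_
    simp only [mul_assoc]
    rw [← Finset.mul_sum]
    exact mul_eq_zero_of_right _ (sum_nullVec (M := fun i j => M i j t) h1)

/-- `M = L M'` where `L` is unit lower bidiagonal with subdiagonal `g 1, g 2, ...` and
`L' = (diag q + shift) L - L (diag q' + shift)`. -/
structure IsFactorStep (F : Filter ℝ) (q q' : ℕ → ℝ → ℂ) (M M' : ℕ → ℕ → ℝ → ℂ)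
    (g : ℕ → ℝ → ℂ) : Prop where
  zero : ∀ t, g 0 t = 0
  diag : ∀ r t, q' r t = q r t + g (r + 1) t - g r t
  factor : ∀ r c t, M r c t = M' r c t + g r t * M' (r - 1) c t
  ode : ∀ r, ∀ᶠ t in F, HasDerivAt (g r) (g r t * (q r t - q' (r - 1) t)) t

theorem det_eq_of_lower_bidiagonal {n : ℕ} {M M' : ℕ → ℕ → ℂ} {g : ℕ → ℂ} (h0 : g 0 = 0)
    (h : ∀ r c, M r c = M' r c + g r * M' (r - 1) c)
    (hdet : (Matrix.of fun i j : Fin n => M i j).det ≠ 0) :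
    (Matrix.of fun i j : Fin n => M' i j).det ≠ 0 := by
  have hmul : (Matrix.of fun i j : Fin n => M i j) =
      (Matrix.of fun i k : Fin n =>
        (if k = i then 1 else 0) + if (k : ℕ) + 1 = i then g i else 0) *
      Matrix.of fun i j : Fin n => M' i j := by
    ext i j
    simp only [Matrix.mul_apply, Matrix.of_apply, add_mul, ite_mul, one_mul, zero_mul,
      Finset.sum_add_distrib, Finset.sum_ite_eq', Finset.mem_univ, if_true]
    rw [h]
    congr 1
    rcases Nat.eq_zero_or_pos (i : ℕ) with hi | hi
    · rw [hi, h0, zero_mul, Finset.sum_eq_zero]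
      intro k _
      rw [if_neg (by omega)]
    · rw [Finset.sum_eq_single (⟨i - 1, by omega⟩ : Fin n)]
      · rw [if_pos (by simp only; omega)]
      · intro k _ hk
        rw [if_neg]
        intro h'
        exact hk (Fin.ext (by simp only; omega))
      · simp
  rw [hmul, Matrix.det_mul] at hdet
  exact right_ne_zero_of_mul hdet

theorem IsLaxFlow.exists_step {F : Filter ℝ} (hF : IsIntervalFilter F) {b : ℕ}
    {q P : ℕ → ℝ → ℂ} {M : ℕ → ℕ → ℝ → ℂ} (h : IsLaxFlow F (b + 1) q P M) :
    ∃ q' M' g, IsLaxFlow F b q' P M' ∧ IsFactorStep F q q' M M' g := by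
  obtain ⟨y, hy0, hy, hnull⟩ := h.exists_left_null hF (by omega)
  let g : ℕ → ℝ → ℂ := fun n t => -(prev (fun k => y k t) n) / y n t
  let q' : ℕ → ℝ → ℂ := fun r t => q r t + g (r + 1) t - g r t
  let M' : ℕ → ℕ → ℝ → ℂ := fun r c => Nat.rec (M 0 c)
    (fun k f t => M (k + 1) c t - g (k + 1) t * f t) r
  have hM0 : ∀ c, M' 0 c = M 0 c := fun c => rfl
  have hM1 : ∀ r c, M' (r + 1) c = fun t => M (r + 1) c t - g (r + 1) t * M' r c t :=
    fun r c => rfl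
  have hg0 : ∀ t, g 0 t = 0 := fun t => by simp [g]
  have hfac : ∀ r c t, M r c t = M' r c t + g r t * M' (r - 1) c t := by
    intro r c t
    cases r with
    | zero => rw [hg0, hM0]; ring
    | succ r => rw [hM1, Nat.add_sub_cancel]; ring
  have hprev : ∀ n, ∀ᶠ t in F, prev (fun k => y k t) n = -(g n t * y n t) := by
    intro n
    filter_upwards [hy0 n] with t ht
    simp only [g]
    rw [div_mul_cancel₀ _ ht, neg_neg]
  have hgode : ∀ r, ∀ᶠ t in F, HasDerivAt (g r) (g r t * (q r t - q' (r - 1) t)) t := by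
    intro r
    cases r with
    | zero =>
      have : g 0 = fun _ => 0 := funext hg0
      refine Eventually.of_forall fun t => ?_
      rw [this]
      simpa using hasDerivAt_const t (0 : ℂ)
    | succ r =>
      filter_upwards [hy0 (r + 1), hy (r + 1), hy r, hprev (r + 1), hprev r] with t h0 h1 h2 h3 h4
      refine (h2.neg.div h1 h0).congr_deriv ?_
      rw [div_eq_iff (pow_ne_zero 2 h0), h3, h4]
      simp only [prev_succ] at h3
      simp only [Pi.neg_apply, h3, q', Nat.add_sub_cancel]
      ring
  have hpartial : ∀ c r, ∀ᶠ t in F,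
      y r t * M' r c t = ∑ k ∈ Finset.range (r + 1), y k t * M k c t := by
    intro c r
    induction r with
    | zero => exact Eventually.of_forall fun t => by simp [hM0]
    | succ r ih =>
      filter_upwards [ih, hprev (r + 1)] with t h1 h2
      rw [Finset.sum_range_succ, ← h1, hM1]
      simp only [prev_succ] at h2
      linear_combination -(M' r c t) * h2
  have hlow : ∀ r c, c + b < r → ∀ᶠ t in F, M' r c t = 0 := by
    intro r c hr
    have hl : ∀ᶠ t in F, ∀ k ≤ r, c + (b + 1) < k → M k c t = 0 := by
      refine eventually_forall_le (fun k => ?_) r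
      by_cases hk : c + (b + 1) < k
      · exact (h.lower k c hk).mono fun t ht _ => ht
      · exact Eventually.of_forall fun t h' => absurd h' hk
    filter_upwards [hpartial c r, hl, hnull c, hy0 r] with t h1 h2 h3 h4
    have h5 : ∑ k ∈ Finset.range (c + (b + 1) + 1), y k t * M k c t
        = ∑ k ∈ Finset.range (r + 1), y k t * M k c t := by
      refine Finset.sum_subset (Finset.range_subset_range.2 (by omega)) fun k hk hk' => ?_
      rw [Finset.mem_range] at hk hk'
      rw [h2 k (by omega) (by omega), mul_zero]
    rw [← h5, h3] at h1
    exact (mul_eq_zero.1 h1).resolve_left h4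
  have hup : ∀ r c, r + 1 < c → ∀ᶠ t in F, M' r c t = 0 := by
    intro r
    induction r with
    | zero => exact fun c hc => h.upper 0 c hc
    | succ r ih =>
      intro c hc
      filter_upwards [h.upper (r + 1) c hc, ih c (by omega)] with t h1 h2
      simp only [hM1, h1, h2, mul_zero, sub_zero]
  refine ⟨q', M', g, ⟨?_, ?_, ?_, hup, hlow, ?_, ?_⟩, hg0, fun _ _ => rfl, hfac, hgode⟩
  · intro r
    filter_upwards [h.continuousAt r, hgode (r + 1), hgode r] with t h1 h2 h3
    exact (h1.add h2.continuousAt).sub h3.continuousAt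
  · intro r c
    induction r with
    | zero =>
      filter_upwards [h.ode 0 c] with t h1
      rw [hM0]
      refine h1.congr_deriv ?_
      cases c <;>
      · simp only [laxRhs, hM0, hM1, prev_succ, prev_zero, q', hg0]
        ring
    | succ r ih =>
      filter_upwards [h.ode (r + 1) c, ih, hgode (r + 1)] with t h1 h2 h3
      refine (h1.sub (h3.mul h2)).congr_deriv ?_
      have e2 : M' (r + 2) c t = M (r + 2) c t - g (r + 2) t * M' (r + 1) c t := rfl
      cases c <;>
      · simp only [laxRhs, prev_succ, prev_zero, q', Nat.add_sub_cancel]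
        simp only [hfac (r + 1), hfac (r + 1 + 1), Nat.add_sub_cancel]
        ring
  · intro r
    cases r with
    | zero => exact h.superdiag 0
    | succ r =>
      filter_upwards [h.superdiag (r + 1), hup r (r + 1 + 1) (by omega)] with t h1 h2
      simp only [hM1, h1, h2, mul_zero, sub_zero]
  · intro c
    filter_upwards [h.outer c, hlow (c + b + 1) c (by omega)] with t h1 h2 h3
    apply h1
    rw [← add_assoc, hfac, h2, Nat.add_sub_cancel, h3, mul_zero, add_zero]
  · intro n
    filter_upwards [h.det_ne_zero n] with t ht
    exact det_eq_of_lower_bidiagonal (g := fun r => g r t) (M := fun i j => M i j t)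
      (M' := fun i j => M' i j t) (hg0 t) (fun r c => hfac r c t) ht

/-- A flow with `b` lower diagonals is a product of `b` lower bidiagonal factors and an upper
bidiagonal one. -/
theorem IsLaxFlow.exists_factorization {F : Filter ℝ} (hF : IsIntervalFilter F)
    {P : ℕ → ℝ → ℂ} (b : ℕ) :
    ∀ (q : ℕ → ℝ → ℂ) (M : ℕ → ℕ → ℝ → ℂ), IsLaxFlow F b q P M →
    ∃ (qs : ℕ → ℕ → ℝ → ℂ) (Ms : ℕ → ℕ → ℕ → ℝ → ℂ) (gs : ℕ → ℕ → ℝ → ℂ),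
      qs 0 = q ∧ Ms 0 = M ∧
      (∀ k < b, IsFactorStep F (qs k) (qs (k + 1)) (Ms k) (Ms (k + 1)) (gs k)) ∧
      ∀ k ≤ b, IsLaxFlow F (b - k) (qs k) P (Ms k) := by
  induction b with
  | zero =>
    intro q M h
    refine ⟨fun _ => q, fun _ => M, fun _ _ _ => 0, rfl, rfl, fun k hk => by omega, ?_⟩
    intro k hk
    obtain rfl : k = 0 := by omega
    exact h
  | succ b ih =>
    intro q M h
    obtain ⟨q', M', g, h', hstep⟩ := h.exists_step hF
    obtain ⟨qs, Ms, gs, hq, hM, hs, hf⟩ := ih q' M' h'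
    subst hq hM
    refine ⟨fun k => Nat.casesOn k q qs, fun k => Nat.casesOn k M Ms,
      fun k => Nat.casesOn k g gs, rfl, rfl, ?_, ?_⟩
    · intro k hk
      cases k with
      | zero => exact hstep
      | succ k => exact hs k (by omega)
    · intro k hk
      cases k with
      | zero => exact h
      | succ k => simpa only [Nat.add_sub_add_right] using hf k (by omega)

/-- The entry in row `r` of the subdiagonal of `L p g m`. -/
def subdiag (p : ℕ) (g : ℕ → ℂ) (m r : ℕ) : ℂ :=
  if r = 0 then 0 else g ((r - 1) * p + (r - 1) + m + 1)

@[simp] theorem subdiag_zero (p : ℕ) (g : ℕ → ℂ) (m : ℕ) : subdiag p g m 0 = 0 := rfl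

@[simp] theorem subdiag_succ (p : ℕ) (g : ℕ → ℂ) (m r : ℕ) :
    subdiag p g m (r + 1) = g (r * p + r + m + 1) := rfl

theorem mul_L_apply (p : ℕ) (g : ℕ → ℂ) (m : ℕ) (N : Matrix ℕ ℕ ℂ) (r c : ℕ) :
    mul (L p g m) N r c = N r c + subdiag p g m r * N (r - 1) c := by
  simp only [mul, L, Matrix.of_apply]
  cases r with
  | zero =>
    rw [finsum_eq_single _ 0]
    · simp
    · intro k hk
      rw [if_neg (Ne.symm hk), if_neg (by omega), zero_mul]
  | succ r =>
    rw [finsum_eq_sum_of_support_subset (s := {r + 1, r})]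
    · rw [Finset.sum_pair (by omega), if_pos rfl, if_neg (by omega), if_pos rfl, subdiag_succ,
        one_mul, Nat.add_sub_cancel]
    · intro k hk
      rw [Function.mem_support] at hk
      by_contra hk'
      simp only [Finset.coe_insert, Finset.coe_singleton, Set.mem_insert_iff,
        Set.mem_singleton_iff, not_or] at hk'
      apply hk
      rw [if_neg (by omega), if_neg (by omega), zero_mul]

theorem mul_U_apply (p : ℕ) (g : ℕ → ℂ) (N : Matrix ℕ ℕ ℂ) (r c : ℕ) :
    mul (U p g) N r c = g (r * p + r + 1) * N r c + N (r + 1) c := by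
  simp only [mul, U, Matrix.of_apply]
  rw [finsum_eq_sum_of_support_subset (s := {r, r + 1})]
  · rw [Finset.sum_pair (by omega), if_pos rfl, if_neg (by omega), if_pos rfl, one_mul]
  · intro k hk
    rw [Function.mem_support] at hk
    by_contra hk'
    simp only [Finset.coe_insert, Finset.coe_singleton, Set.mem_insert_iff,
      Set.mem_singleton_iff, not_or] at hk'
    apply hk
    rw [if_neg (by omega), if_neg (by omega), zero_mul]

/-- The product `L⁽ˢ⁺¹⁾ ⋯ L⁽ˢ⁺ⁿ⁾ N`. -/
noncomputable def chain (p : ℕ) (g : ℕ → ℂ) : ℕ → ℕ → Matrix ℕ ℕ ℂ → Matrix ℕ ℕ ℂ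
  | _, 0, N => N
  | s, n + 1, N => mul (L p g (s + 1)) (chain p g (s + 1) n N)

theorem foldr_mul_range' (p : ℕ) (g : ℕ → ℂ) (n : ℕ) : ∀ (s : ℕ) (N : Matrix ℕ ℕ ℂ),
    ((List.range' (s + 1) n).map (L p g)).foldr mul N = chain p g s n N := by
  induction n with
  | zero => exact fun s N => rfl
  | succ n ih =>
    intro s N
    rw [List.range'_succ, List.map_cons, List.foldr_cons, ih]
    rfl

theorem circular_eq_chain (p : ℕ) (g : ℕ → ℂ) (i : ℕ) :
    circular p g i = chain p g i (p - i) (mul (U p g) (chain p g 0 i 1)) := by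
  simp only [circular, prod, List.foldr_append, List.foldr_cons, List.foldr_nil]
  rw [← foldr_mul_range', ← foldr_mul_range']

theorem chain_succ_apply (p : ℕ) (g : ℕ → ℂ) (s n : ℕ) (N : Matrix ℕ ℕ ℂ) (r c : ℕ) :
    chain p g s (n + 1) N r c = chain p g (s + 1) n N r c
      + subdiag p g (s + 1) r * chain p g (s + 1) n N (r - 1) c :=
  mul_L_apply ..

section Bands

variable {p : ℕ} {g : ℕ → ℂ} {N : Matrix ℕ ℕ ℂ}

theorem chain_eq_zero_of_upper {d : ℕ} (hN : ∀ r c, r + d < c → N r c = 0) (n : ℕ) :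
    ∀ s r c, r + d < c → chain p g s n N r c = 0 := by
  induction n with
  | zero => exact fun s => hN
  | succ n ih =>
    intro s r c h
    rw [chain_succ_apply, ih _ _ _ h, ih _ _ _ (by omega), mul_zero, add_zero]

theorem chain_eq_zero_of_lower {d : ℕ} (hN : ∀ r c, c + d < r → N r c = 0) (n : ℕ) :
    ∀ s r c, c + d + n < r → chain p g s n N r c = 0 := by
  induction n with
  | zero => exact fun s r c h => hN r c h
  | succ n ih =>
    intro s r c h
    rw [chain_succ_apply, ih _ _ _ (by omega), ih _ _ _ (by omega), mul_zero, add_zero]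

theorem chain_apply_of_eq {d : ℕ} (hN : ∀ r c, r + d < c → N r c = 0) (n : ℕ) :
    ∀ s r, chain p g s n N r (r + d) = N r (r + d) := by
  induction n with
  | zero => exact fun s r => rfl
  | succ n ih =>
    intro s r
    rw [chain_succ_apply, ih]
    cases r with
    | zero => rw [subdiag_zero, zero_mul, add_zero]
    | succ r => rw [chain_eq_zero_of_upper hN _ _ _ _ (by omega), mul_zero, add_zero]

theorem chain_apply_next {d : ℕ} (hN : ∀ r c, r + (d + 1) < c → N r c = 0)
    (hN1 : ∀ r, N r (r + (d + 1)) = 1) (n : ℕ) :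
    ∀ s r, chain p g s n N r (r + d) =
      N r (r + d) + ∑ k ∈ Finset.range n, subdiag p g (s + 1 + k) r := by
  induction n with
  | zero => intro s r; simp [chain]
  | succ n ih =>
    intro s r
    rw [chain_succ_apply, ih, Finset.sum_range_succ', Nat.add_zero]
    have h1 : subdiag p g (s + 1) r * chain p g (s + 1) n N (r - 1) (r + d)
        = subdiag p g (s + 1) r := by
      cases r with
      | zero => simp
      | succ r =>
        have := chain_apply_of_eq (p := p) (g := g) hN n (s + 1) r
        rw [hN1, ← add_assoc, Nat.add_right_comm r d 1] at this
        rw [Nat.add_sub_cancel, this, mul_one]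
    rw [h1, add_assoc]
    congr 2
    refine Finset.sum_congr rfl fun k _ => ?_
    rw [show s + 1 + 1 + k = s + 1 + (k + 1) by omega]

end Bands

section Circular

variable (p : ℕ) (g : ℕ → ℂ) (i : ℕ)

theorem lowerChain_eq_zero_of_upper {r c : ℕ} (h : r < c) :
    chain p g 0 i (1 : Matrix ℕ ℕ ℂ) r c = 0 :=
  chain_eq_zero_of_upper (d := 0) (fun r c h => Matrix.one_apply_ne (by omega)) i 0 r c h

theorem lowerChain_diag (r : ℕ) : chain p g 0 i (1 : Matrix ℕ ℕ ℂ) r r = 1 :=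
  (chain_apply_of_eq (d := 0) (fun r c h => Matrix.one_apply_ne (by omega)) i 0 r).trans
    (Matrix.one_apply_eq r)

theorem lowerChain_eq_zero_of_lower {r c : ℕ} (h : c + i < r) :
    chain p g 0 i (1 : Matrix ℕ ℕ ℂ) r c = 0 :=
  chain_eq_zero_of_lower (d := 0) (fun r c h => Matrix.one_apply_ne (by omega)) i 0 r c h

theorem lowerChain_subdiag (r : ℕ) : chain p g 0 i (1 : Matrix ℕ ℕ ℂ) (r + 1) r
    = ∑ k ∈ Finset.range i, subdiag p g (k + 1) (r + 1) := by
  have : ∀ n s, chain p g s n (1 : Matrix ℕ ℕ ℂ) (r + 1) r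
      = ∑ k ∈ Finset.range n, subdiag p g (s + 1 + k) (r + 1) := by
    intro n
    induction n with
    | zero => intro s; exact Matrix.one_apply_ne (by omega)
    | succ n ih =>
      intro s
      rw [chain_succ_apply, ih, Finset.sum_range_succ', Nat.add_zero, Nat.add_sub_cancel]
      have h1 : chain p g (s + 1) n (1 : Matrix ℕ ℕ ℂ) r r = 1 :=
        (chain_apply_of_eq (d := 0) (fun r c h => Matrix.one_apply_ne (by omega)) n (s + 1) r).trans
          (Matrix.one_apply_eq r)
      rw [h1, mul_one]
      congr 1
      refine Finset.sum_congr rfl fun k _ => ?_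
      rw [show s + 1 + 1 + k = s + 1 + (k + 1) by omega]
  rw [this]
  refine Finset.sum_congr rfl fun k _ => ?_
  rw [show 0 + 1 + k = k + 1 by omega]

theorem upperMul_eq_zero {r c : ℕ} (h : r + 1 < c) :
    mul (U p g) (chain p g 0 i 1) r c = 0 := by
  rw [mul_U_apply, lowerChain_eq_zero_of_upper p g i (by omega),
    lowerChain_eq_zero_of_upper p g i (by omega), mul_zero, add_zero]

theorem upperMul_superdiag (r : ℕ) : mul (U p g) (chain p g 0 i 1) r (r + 1) = 1 := by
  rw [mul_U_apply, lowerChain_eq_zero_of_upper p g i (by omega), lowerChain_diag, mul_zero,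
    zero_add]

theorem circular_eq_zero_of_upper {r c : ℕ} (h : r + 1 < c) : circular p g i r c = 0 := by
  rw [circular_eq_chain]
  exact chain_eq_zero_of_upper (d := 1) (fun r c h => upperMul_eq_zero p g i h) _ _ _ _ h

theorem circular_superdiag (r : ℕ) : circular p g i r (r + 1) = 1 := by
  rw [circular_eq_chain, chain_apply_of_eq (d := 1) (fun r c h => upperMul_eq_zero p g i h),
    upperMul_superdiag]

theorem circular_eq_zero_of_lower (hi : i ≤ p) {r c : ℕ} (h : c + p < r) :
    circular p g i r c = 0 := by
  rw [circular_eq_chain]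
  refine chain_eq_zero_of_lower (d := i) (fun r c h => ?_) _ _ _ _ (by omega)
  rw [mul_U_apply, lowerChain_eq_zero_of_lower p g i h,
    lowerChain_eq_zero_of_lower p g i (by omega), mul_zero, add_zero]

theorem circular_diag (r : ℕ) : circular p g i r r = g (r * p + r + 1)
    + ∑ k ∈ Finset.range i, subdiag p g (k + 1) (r + 1)
    + ∑ k ∈ Finset.range (p - i), subdiag p g (i + 1 + k) r := by
  have h := chain_apply_next (p := p) (g := g) (d := 0)
    (fun r c h => upperMul_eq_zero p g i h) (upperMul_superdiag p g i) (p - i) i r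
  rw [Nat.add_zero] at h
  rw [circular_eq_chain, h, mul_U_apply, lowerChain_diag, lowerChain_subdiag, mul_one]

end Circular

/-- The sum of `p + 1` consecutive values of `g`, the last one being `g n`. -/
def window (p : ℕ) (g : ℕ → ℂ) (n : ℕ) : ℂ := ∑ s ∈ Finset.range (p + 1), g (n - s)

theorem window_succ (p : ℕ) (g : ℕ → ℂ) (n : ℕ) :
    window p g (n + 1) + g (n - p) = window p g n + g (n + 1) := by
  rw [window, window, Finset.sum_range_succ', Finset.sum_range_succ]
  simp only [Nat.add_sub_add_right, Nat.sub_zero]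
  ring

theorem window_add_sub_window (p : ℕ) {g : ℕ → ℂ} (h0 : g 0 = 0) (n : ℕ) :
    window p g (n + p) - window p g n = ∑ i ∈ Finset.Icc 1 p, g (n + i)
      - ∑ i ∈ Finset.Icc 1 p, if i < n then g (n - i) else 0 := by
  have hIcc : ∀ f : ℕ → ℂ, ∑ i ∈ Finset.Icc 1 p, f i = ∑ i ∈ Finset.range p, f (i + 1) := by
    intro f
    rw [Finset.range_eq_Ico, Finset.sum_Ico_add' f 0 p 1]
    rfl
  have h1 : window p g (n + p) = ∑ i ∈ Finset.range (p + 1), g (n + i) := by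
    rw [window, ← Finset.sum_range_reflect]
    refine Finset.sum_congr rfl fun i hi => ?_
    have := Finset.mem_range.1 hi
    congr 1
    omega
  have h2 : ∀ i, (if i < n then g (n - i) else 0) = g (n - i) := by
    intro i
    split_ifs with h
    · rfl
    · rw [Nat.sub_eq_zero_of_le (by omega), h0]
  simp only [h2]
  rw [h1, window, hIcc, hIcc, Finset.sum_range_succ', Finset.sum_range_succ' (fun i => g (n - i))]
  simp only [Nat.add_zero, Nat.sub_zero]
  ring

/-- The sum of `p + 1` consecutive values of `g` that is the diagonal entry in row `r` of the
`i`-th circular permutation. -/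
def diagWindow (p : ℕ) (g : ℕ → ℂ) (i r : ℕ) : ℂ := window p g (r * p + r + 1 + i)

section Window

variable (p : ℕ) {g : ℕ → ℂ}

theorem diagWindow_step (h0 : g 0 = 0) {m : ℕ} (hm : m < p) (r : ℕ) :
    diagWindow p g (m + 1) r + subdiag p g (m + 1) r
      = diagWindow p g m r + subdiag p g (m + 1) (r + 1) := by
  have h := window_succ p g (r * p + r + 1 + m)
  have h1 : subdiag p g (m + 1) r = g (r * p + r + 1 + m - p) := by
    cases r with
    | zero => rw [subdiag_zero, Nat.sub_eq_zero_of_le (by omega), h0]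
    | succ r =>
      rw [subdiag_succ, Nat.succ_mul]
      congr 1
      omega
  rw [h1, subdiag_succ, show r * p + r + (m + 1) + 1 = r * p + r + 1 + m + 1 by omega]
  exact h

theorem diagWindow_zero_succ (r : ℕ) :
    diagWindow p g 0 (r + 1) + g (r * p + r + 1)
      = diagWindow p g p r + g ((r + 1) * p + (r + 1) + 1) := by
  have h := window_succ p g (r * p + r + 1 + p)
  rw [Nat.add_sub_cancel] at h
  rw [diagWindow, diagWindow, Nat.add_zero,
    show (r + 1) * p + (r + 1) + 1 = r * p + r + 1 + p + 1 by rw [Nat.succ_mul]; omega]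
  exact h

theorem diagWindow_add_sum (h0 : g 0 = 0) {i : ℕ} (hi : i ≤ p) (r : ℕ) :
    diagWindow p g i r + ∑ k ∈ Finset.range i, subdiag p g (k + 1) r
      = diagWindow p g 0 r + ∑ k ∈ Finset.range i, subdiag p g (k + 1) (r + 1) := by
  induction i with
  | zero => rfl
  | succ i ih =>
    rw [Finset.sum_range_succ, Finset.sum_range_succ]
    linear_combination ih (by omega) + diagWindow_step p h0 (m := i) (by omega) r

theorem diagWindow_zero (h0 : g 0 = 0) (r : ℕ) :
    diagWindow p g 0 r
      = g (r * p + r + 1) + ∑ k ∈ Finset.range p, subdiag p g (k + 1) r := by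
  induction r with
  | zero =>
    have h := window_succ p g 0
    have hw : window p g 0 = 0 := Finset.sum_eq_zero fun s _ => by rw [Nat.zero_sub, h0]
    rw [Nat.zero_sub, h0, hw] at h
    simpa [diagWindow] using h
  | succ r ih =>
    linear_combination ih + diagWindow_zero_succ p (g := g) r
      + diagWindow_add_sum p h0 le_rfl r

theorem circular_diag_eq_diagWindow (h0 : g 0 = 0) {i : ℕ} (hi : i ≤ p) (r : ℕ) :
    circular p g i r r = diagWindow p g i r := by
  obtain ⟨d, rfl⟩ := Nat.exists_eq_add_of_le hi
  have hsum := Finset.sum_range_add (fun k => subdiag (i + d) g (k + 1) r) i d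
  have hsum' : ∑ k ∈ Finset.range d, subdiag (i + d) g (i + 1 + k) r
      = ∑ k ∈ Finset.range d, subdiag (i + d) g (i + k + 1) r :=
    Finset.sum_congr rfl fun k _ => by rw [Nat.add_right_comm]
  rw [circular_diag, Nat.add_sub_cancel_left, hsum']
  linear_combination -(diagWindow_add_sum (i + d) h0 hi r) - diagWindow_zero (i + d) h0 r - hsum

end Window

/-- The derivative of `γ n` at `t` is the one prescribed by the discrete KdV equation. -/
def KdVAt (p : ℕ) (γ : ℕ → ℝ → ℂ) (n : ℕ) (t : ℝ) : Prop :=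
  HasDerivAt (γ n)
    (γ n t * (window p (fun k => γ k t) (n + p) - window p (fun k => γ k t) n)) t

/-- The family `N` satisfies `N' = (diag q + shift) N - N (diag P + shift)`, each entry eventually
along `F`. -/
def HasLaxDeriv (F : Filter ℝ) (q P : ℝ → ℕ → ℂ) (N : ℝ → Matrix ℕ ℕ ℂ) : Prop :=
  ∀ r c, ∀ᶠ t in F, HasDerivAt (fun s => N s r c) (laxRhs (q t) (P t) (N t) r c) t

section Lax

variable {F : Filter ℝ} {p : ℕ} {γ : ℕ → ℝ → ℂ} {P : ℝ → ℕ → ℂ} {N : ℝ → Matrix ℕ ℕ ℂ}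

theorem hasDerivAt_subdiag (hγ : ∀ n, 1 ≤ n → ∀ᶠ t in F, KdVAt p γ n t) (m r : ℕ) :
    ∀ᶠ t in F, HasDerivAt (fun s => subdiag p (fun k => γ k s) (m + 1) r)
      (subdiag p (fun k => γ k t) (m + 1) r *
        (diagWindow p (fun k => γ k t) m r - diagWindow p (fun k => γ k t) (m + 1) (r - 1))) t := by
  cases r with
  | zero =>
    refine Eventually.of_forall fun t => ?_
    simp only [subdiag_zero, zero_mul]
    exact hasDerivAt_const t 0
  | succ r =>
    filter_upwards [hγ (r * p + r + (m + 1) + 1) (by omega)] with t ht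
    simp only [subdiag_succ, Nat.add_sub_cancel, diagWindow]
    rw [show (r + 1) * p + (r + 1) + 1 + m = r * p + r + (m + 1) + 1 + p by
      rw [Nat.succ_mul]; omega,
      show r * p + r + 1 + (m + 1) = r * p + r + (m + 1) + 1 by omega]
    exact ht

theorem HasLaxDeriv.mul_L (h0 : ∀ t, γ 0 t = 0) (hγ : ∀ n, 1 ≤ n → ∀ᶠ t in F, KdVAt p γ n t)
    {m : ℕ} (hm : m < p)
    (hN : HasLaxDeriv F (fun t => diagWindow p (fun k => γ k t) (m + 1)) P N) :
    HasLaxDeriv F (fun t => diagWindow p (fun k => γ k t) m) P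
      (fun t => mul (L p (fun k => γ k t) (m + 1)) (N t)) := by
  intro r c
  filter_upwards [hN r c, hN (r - 1) c, hasDerivAt_subdiag hγ m r] with t h1 h2 h3
  simp only [mul_L_apply]
  refine (h1.add (h3.mul h2)).congr_deriv ?_
  have hq := diagWindow_step p (g := fun k => γ k t) (h0 t) hm r
  cases r with
  | zero =>
    cases c <;>
    · simp only [laxRhs, mul_L_apply, prev_zero, prev_succ, subdiag_zero, zero_mul, add_zero,
        Nat.add_sub_cancel] at hq ⊢
      rw [hq]
      ring
  | succ r =>
    cases c <;>
    · simp only [laxRhs, mul_L_apply, prev_zero, prev_succ, Nat.add_sub_cancel]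
      linear_combination (N t (r + 1) _) * hq

theorem HasLaxDeriv.mul_U (hγ : ∀ n, 1 ≤ n → ∀ᶠ t in F, KdVAt p γ n t)
    (hN : HasLaxDeriv F (fun t => diagWindow p (fun k => γ k t) 0) P N) :
    HasLaxDeriv F (fun t => diagWindow p (fun k => γ k t) p) P
      (fun t => mul (U p (fun k => γ k t)) (N t)) := by
  intro r c
  filter_upwards [hN r c, hN (r + 1) c, hγ (r * p + r + 1) (by omega)] with t h1 h2 h3
  simp only [mul_U_apply]
  refine ((h3.mul h1).add h2).congr_deriv ?_
  have hq := diagWindow_zero_succ p (g := fun k => γ k t) r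
  have e1 : window p (fun k => γ k t) (r * p + r + 1 + p)
    = diagWindow p (fun k => γ k t) p r := rfl
  have e2 : window p (fun k => γ k t) (r * p + r + 1)
    = diagWindow p (fun k => γ k t) 0 r := rfl
  rw [e1, e2]
  cases c <;>
  · simp only [laxRhs, mul_U_apply, prev_zero, prev_succ]
    linear_combination (N t (r + 1) _) * hq

theorem HasLaxDeriv.chain (h0 : ∀ t, γ 0 t = 0) (hγ : ∀ n, 1 ≤ n → ∀ᶠ t in F, KdVAt p γ n t)
    (n : ℕ) : ∀ s, s + n ≤ p →
    HasLaxDeriv F (fun t => diagWindow p (fun k => γ k t) (s + n)) P N →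
    HasLaxDeriv F (fun t => diagWindow p (fun k => γ k t) s) P
      (fun t => chain p (fun k => γ k t) s n (N t)) := by
  induction n with
  | zero => exact fun s _ h => h
  | succ n ih =>
    intro s hs h
    refine HasLaxDeriv.mul_L h0 hγ (by omega) (ih (s + 1) (by omega) ?_)
    rwa [show s + 1 + n = s + (n + 1) by omega]

theorem hasLaxDeriv_one (q : ℝ → ℕ → ℂ) : HasLaxDeriv F q q (fun _ => 1) := by
  intro r c
  refine Eventually.of_forall fun t => (hasDerivAt_const t _).congr_deriv ?_
  have hp : prev ((1 : Matrix ℕ ℕ ℂ) r) c = (1 : Matrix ℕ ℕ ℂ) (r + 1) c := by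
    cases c with
    | zero => rw [prev_zero, Matrix.one_apply_ne (by omega)]
    | succ c => simp [Matrix.one_apply]
  simp only [laxRhs, hp]
  by_cases h : r = c
  · subst h; ring
  · rw [Matrix.one_apply_ne h]; ring

theorem hasLaxDeriv_circular (h0 : ∀ t, γ 0 t = 0)
    (hγ : ∀ n, 1 ≤ n → ∀ᶠ t in F, KdVAt p γ n t) {i : ℕ} (hi : i ≤ p) :
    HasLaxDeriv F (fun t => diagWindow p (fun k => γ k t) i)
      (fun t => diagWindow p (fun k => γ k t) i) (fun t => circular p (fun k => γ k t) i) := by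
  simp only [circular_eq_chain]
  refine HasLaxDeriv.chain h0 hγ (p - i) i (by omega) ?_
  rw [Nat.add_sub_cancel' hi]
  refine HasLaxDeriv.mul_U hγ (HasLaxDeriv.chain h0 hγ i 0 (by omega) ?_)
  rw [Nat.zero_add]
  exact hasLaxDeriv_one _

end Lax

theorem IsTodaSolution.isLaxFlow {p : ℕ} {I : ℕ → Set ℝ} {J : ℝ → Matrix ℕ ℕ ℂ}
    (hJ : IsTodaSolution p I J) (hp : 1 ≤ p) (hout : ∀ i, ∀ t ∈ I i, J t (p + i) i ≠ 0) {C : ℂ}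
    (hdet : ∀ n, ∀ t, (∀ j < n, t ∈ I j) →
      (leadingBlock (J t) n - C • (1 : Matrix (Fin n) (Fin n) ℂ)).det ≠ 0)
    {F : Filter ℝ} (hI : ∀ j, I j ∈ F) :
    IsLaxFlow F p (fun r t => J t r r) (fun r t => J t r r)
      (fun r c t => J t r c - if r = c then C else 0) := by
  have hode : ∀ i j, ∀ᶠ t in F, HasDerivAt (fun s => J s i j)
      ((J t i i - J t j j) * J t i j + J t (i + 1) j - (if j = 0 then 0 else J t i (j - 1))) t := by
    intro i j
    filter_upwards [hI i, hI j, hI (j - 1)] with t h1 h2 h3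
    exact hJ.ode i j t h1 h2 h3
  refine ⟨fun r => ?_, fun r c => ?_, fun r => ?_, fun r c h => ?_, fun r c h => ?_,
    fun c => ?_, fun n => ?_⟩
  · filter_upwards [hode r r] with t ht
    exact ht.continuousAt
  · filter_upwards [hode r c] with t ht
    refine (ht.sub_const _).congr_deriv ?_
    cases c with
    | zero =>
      simp only [laxRhs, prev_zero, if_true, Nat.add_eq_zero_iff, one_ne_zero, and_false, if_false]
      split_ifs with h
      · subst h; ring
      · ring
    | succ c =>
      simp only [laxRhs, prev_succ, Nat.add_sub_cancel, Nat.add_right_cancel_iff,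
        Nat.succ_ne_zero, if_false]
      by_cases h : r = c + 1
      · subst h; simp; ring
      · simp only [if_neg h]; ring
  · filter_upwards [hI (r + 1)] with t ht
    rw [hJ.superdiag r t ht, if_neg (by omega), sub_zero]
  · filter_upwards [hI c] with t ht
    rw [hJ.upper r c h t ht, if_neg (by omega), sub_zero]
  · filter_upwards [hI c] with t ht
    rw [hJ.lower r c h t ht, if_neg (by omega), sub_zero]
  · filter_upwards [hI c] with t ht
    rw [if_neg (by omega), sub_zero, Nat.add_comm]
    exact hout c t ht
  · have hall : ∀ᶠ t in F, ∀ j < n, t ∈ I j :=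
      (eventually_all_finite (Set.finite_Iio n)).2 fun j _ => hI j
    filter_upwards [hall] with t ht
    convert hdet n t ht using 2
    ext i j
    simp [leadingBlock, Matrix.one_apply, Fin.ext_iff]

/-- A banded flow arising from a Toda solution is, up to the shift by `C`, the product of the
bidiagonal factors of a solution of the discrete KdV equation. -/
theorem IsLaxFlow.exists_kdV {F : Filter ℝ} (hF : IsIntervalFilter F) {p : ℕ} {C : ℂ}
    {q : ℕ → ℝ → ℂ} {M : ℕ → ℕ → ℝ → ℂ} (h : IsLaxFlow F p q q M)
    (hq : ∀ r t, q r t = M r r t + C) :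
    ∃ γ : ℕ → ℝ → ℂ, (∀ t, γ 0 t = 0) ∧ (∀ n, 1 ≤ n → ∀ᶠ t in F, KdVAt p γ n t) ∧
      ∀ r c, ∀ᶠ t in F, M r c t = circular p (fun k => γ k t) 0 r c := by
  obtain ⟨qs, Ms, gs, hq0, hM0, hstep, hflow⟩ := h.exists_factorization hF
  let γ : ℕ → ℝ → ℂ := fun n => if n = 0 then fun _ => 0 else
    if (n - 1) % (p + 1) = 0 then Ms p ((n - 1) / (p + 1)) ((n - 1) / (p + 1))
    else gs ((n - 1) % (p + 1) - 1) ((n - 1) / (p + 1) + 1)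
  have hidx : ∀ r m, m ≤ p → (r * p + r + m + 1 - 1) % (p + 1) = m ∧
      (r * p + r + m + 1 - 1) / (p + 1) = r := by
    intro r m hm
    rw [Nat.add_sub_cancel, show r * p + r + m = m + (p + 1) * r by ring]
    rw [Nat.add_mul_mod_self_left, Nat.add_mul_div_left _ _ (by omega),
      Nat.mod_eq_of_lt (by omega), Nat.div_eq_of_lt (by omega), Nat.zero_add]
    exact ⟨rfl, rfl⟩
  have hγ0 : ∀ t, γ 0 t = 0 := fun t => rfl
  have hγU : ∀ r, γ (r * p + r + 1) = Ms p r r := by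
    intro r
    obtain ⟨h1, h2⟩ := hidx r 0 (by omega)
    rw [Nat.add_zero] at h1 h2
    simp only [γ, h1, h2, if_true, Nat.succ_ne_zero, if_false]
  have hγL : ∀ r m, m < p → γ (r * p + r + (m + 1) + 1) = gs m (r + 1) := by
    intro r m hm
    obtain ⟨h1, h2⟩ := hidx r (m + 1) (by omega)
    simp only [γ, h1, h2, Nat.succ_ne_zero, if_false]
    rfl
  have hsub : ∀ t, ∀ m < p, ∀ r, subdiag p (fun k => γ k t) (m + 1) r = gs m r t := by
    intro t m hm r
    cases r with
    | zero => rw [subdiag_zero, (hstep m hm).zero]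
    | succ r => rw [subdiag_succ, hγL r m hm]
  have hdiag : ∀ r, ∀ i ≤ p, ∀ᶠ t in F,
      M r r t = Ms i r r t + ∑ k ∈ Finset.range i, gs k r t := by
    intro r i
    induction i with
    | zero => intro _; exact Eventually.of_forall fun t => by simp [hM0]
    | succ i ih =>
      intro hi
      have h1 : ∀ᶠ t in F, gs i r t * Ms (i + 1) (r - 1) r t = gs i r t := by
        cases r with
        | zero => exact Eventually.of_forall fun t => by rw [(hstep i hi).zero, zero_mul]
        | succ r =>
          filter_upwards [(hflow (i + 1) hi).superdiag r] with t ht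
          rw [Nat.add_sub_cancel, ht, mul_one]
      filter_upwards [ih (by omega), h1] with t h2 h3
      rw [h2, (hstep i hi).factor, h3, Finset.sum_range_succ]
      ring
  have hqs : ∀ r i, i ≤ p → ∀ᶠ t in F, qs i r t = C + diagWindow p (fun k => γ k t) i r := by
    intro r i hi
    have hsum : ∀ t, ∀ i ≤ p, qs i r t + ∑ k ∈ Finset.range i, gs k r t
        = qs 0 r t + ∑ k ∈ Finset.range i, gs k (r + 1) t := by
      intro t i
      induction i with
      | zero => intro _; simp
      | succ i ih =>
        intro hi
        rw [Finset.sum_range_succ, Finset.sum_range_succ, (hstep i hi).diag]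
        linear_combination ih (by omega)
    filter_upwards [hdiag r p le_rfl] with t ht
    have h1 := diagWindow_zero p (g := fun k => γ k t) (hγ0 t) r
    have h2 := diagWindow_add_sum p (g := fun k => γ k t) (hγ0 t) hi r
    have h3 := hsum t i hi
    have e : ∀ j ≤ p, ∀ r', ∑ k ∈ Finset.range j, subdiag p (fun k => γ k t) (k + 1) r'
        = ∑ k ∈ Finset.range j, gs k r' t := fun j hj r' =>
      Finset.sum_congr rfl fun k hk => hsub t k (by have := Finset.mem_range.1 hk; omega) r'
    rw [e p le_rfl, hγU] at h1
    rw [e i hi, e i hi] at h2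
    rw [hq0, hq] at h3
    linear_combination h3 - h2 - h1 + ht
  refine ⟨γ, hγ0, ?_, ?_⟩
  · intro n hn
    obtain ⟨r, m, hm, rfl⟩ : ∃ r m, m ≤ p ∧ n = r * p + r + m + 1 := by
      refine ⟨(n - 1) / (p + 1), (n - 1) % (p + 1),
        Nat.lt_succ_iff.1 (Nat.mod_lt _ (by omega)), ?_⟩
      have := Nat.div_add_mod (n - 1) (p + 1)
      rw [Nat.add_mul] at this
      rw [Nat.mul_comm _ p]
      omega
    cases m with
    | zero =>
      have hflow' := hflow p le_rfl
      rw [Nat.sub_self] at hflow'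
      have hl : ∀ᶠ t in F, prev (fun c => Ms p r c t) r = 0 := by
        cases r with
        | zero => exact Eventually.of_forall fun t => rfl
        | succ r => exact hflow'.lower (r + 1) r (by omega)
      filter_upwards [hflow'.ode r r, hflow'.lower (r + 1) r (by omega), hl,
        hqs r p le_rfl, hqs r 0 (by omega)] with t h1 h2 h3 h4 h5
      rw [Nat.add_zero, KdVAt, hγU]
      refine h1.congr_deriv ?_
      rw [hq0] at h5
      simp only [laxRhs]
      rw [h2, h3, h4, h5, diagWindow, diagWindow, Nat.add_zero]
      ring
    | succ m =>
      filter_upwards [(hstep m hm).ode (r + 1), hqs (r + 1) m (by omega), hqs r (m + 1) hm]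
        with t h1 h2 h3
      rw [KdVAt, hγL r m hm]
      refine h1.congr_deriv ?_
      rw [Nat.add_sub_cancel, h2, h3, diagWindow, diagWindow,
        show (r + 1) * p + (r + 1) + 1 + m = r * p + r + (m + 1) + 1 + p by
          rw [Nat.succ_mul]; omega,
        show r * p + r + 1 + (m + 1) = r * p + r + (m + 1) + 1 by omega]
      ring
  · have hchain : ∀ n ≤ p, ∀ r c, ∀ᶠ t in F,
        chain p (fun k => γ k t) (p - n) n (mul (U p fun k => γ k t) 1) r c
          = Ms (p - n) r c t := by
      intro n
      induction n with
      | zero =>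
        intro _ r c
        have hflow' := hflow p le_rfl
        rw [Nat.sub_self] at hflow'
        have hval : ∀ t, chain p (fun k => γ k t) (p - 0) 0 (mul (U p fun k => γ k t) 1) r c
            = Ms p r r t * (1 : Matrix ℕ ℕ ℂ) r c + (1 : Matrix ℕ ℕ ℂ) (r + 1) c := by
          intro t
          rw [← hγU r]
          exact mul_U_apply ..
        suffices h : ∀ᶠ t in F, Ms p r r t * (1 : Matrix ℕ ℕ ℂ) r c
            + (1 : Matrix ℕ ℕ ℂ) (r + 1) c = Ms p r c t from h.mono fun t ht => (hval t).trans ht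
        rcases lt_trichotomy c r with hc | hc | hc
        · filter_upwards [hflow'.lower r c (by omega)] with t ht
          rw [ht, Matrix.one_apply_ne (by omega), Matrix.one_apply_ne (by omega)]
          ring
        · subst hc
          refine Eventually.of_forall fun t => ?_
          rw [Matrix.one_apply_eq, Matrix.one_apply_ne (by omega)]
          ring
        · rcases Nat.eq_or_lt_of_le hc with hc | hc
          · subst hc
            filter_upwards [hflow'.superdiag r] with t ht
            rw [ht, Matrix.one_apply_eq, Matrix.one_apply_ne (by omega)]
            ring
          · filter_upwards [hflow'.upper r c hc] with t ht
            rw [ht, Matrix.one_apply_ne (by omega), Matrix.one_apply_ne (by omega)]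
            ring
      | succ n ih =>
        intro hn r c
        have hs := hstep (p - (n + 1)) (by omega)
        have hi : p - (n + 1) + 1 = p - n := by omega
        filter_upwards [ih (by omega) r c, ih (by omega) (r - 1) c] with t h1 h2
        rw [chain_succ_apply, hsub t _ (by omega), hs.factor, hi, h1, h2]
    intro r c
    filter_upwards [hchain p le_rfl r c] with t ht
    rw [Nat.sub_self, hM0] at ht
    rw [circular_eq_chain, ← ht]
    rfl

end FullToda

open FullToda Filter in
theorem theorem1 (p : ℕ) (hp : 1 ≤ p) (I : ℕ → Set ℝ) (J : ℝ → Matrix ℕ ℕ ℂ)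
    (hJ : FullToda.IsTodaSolution p I J)
    (hout : ∀ i, ∀ t ∈ I i, J t (p + i) i ≠ 0)
    (C : ℂ)
    (hdet : ∀ n, ∀ t, (∀ j < n, t ∈ I j) →
      (FullToda.leadingBlock (J t) n - C • (1 : Matrix (Fin n) (Fin n) ℂ)).det ≠ 0) :
    ∃ (γ : ℕ → ℝ → ℂ) (O : ℕ → Set ℝ) (K : ℕ → Set ℝ) (JJ : ℕ → ℝ → Matrix ℕ ℕ ℂ),
      FullToda.IsKdVSolution p O γ ∧
      -- on `K c` the column `c` of `J`, and all the `γ n` that enter the columns `c` of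
      -- the circular permutations, are defined
      (∀ c, K c ⊆ I c) ∧
      (∀ c n, 1 ≤ n → n ≤ (c + p + 1) * (p + 1) → K c ⊆ O n) ∧
      JJ 0 = J ∧
      (∀ i, 1 ≤ i → i ≤ p → FullToda.IsTodaSolution p K (JJ i)) ∧
      (∀ i, i ≤ p → ∀ r c, ∀ t ∈ K c,
        JJ i t r c =
          (C • (1 : Matrix ℕ ℕ ℂ) + FullToda.circular p (fun n => γ n t) i) r c) := by
  obtain ⟨F, hF, hI⟩ := hJ.intervals.exists_filter
  obtain ⟨γ, h0, hγ, hMγ⟩ := (hJ.isLaxFlow hp hout hdet hI).exists_kdV hF (C := C)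
    (fun r t => by simp)
  set Γ : ℝ → ℕ → ℂ := fun t n => γ n t with hΓ
  have hlax : ∀ i ≤ p, HasLaxDeriv F (fun t => diagWindow p (Γ t) i)
      (fun t => diagWindow p (Γ t) i) (fun t => circular p (Γ t) i) :=
    fun i hi => hasLaxDeriv_circular h0 hγ hi
  have hO : ∀ n, ∃ O ∈ F, O ⊆ {t | 1 ≤ n → KdVAt p γ n t} ∧ IsOpen O ∧ O.OrdConnected := by
    refine fun n => hF.exists_interval _ ?_
    by_cases hn : 1 ≤ n
    · exact (hγ n hn).mono fun t ht _ => ht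
    · exact Eventually.of_forall fun t h => absurd h hn
  choose O hOF hOs hOo using hO
  have hK : ∀ c, ∃ K ∈ F, K ⊆ {t | t ∈ I c ∧ (∀ n ≤ (c + p + 1) * (p + 1), t ∈ O n) ∧
      (∀ r ≤ c + p, J t r c - (if r = c then C else 0) = circular p (Γ t) 0 r c) ∧
      ∀ i ≤ p, ∀ r ≤ c + p, ∀ j ≤ c, HasDerivAt (fun s => circular p (Γ s) i r j)
        (laxRhs (diagWindow p (Γ t) i) (diagWindow p (Γ t) i) (circular p (Γ t) i) r j) t} ∧
      IsOpen K ∧ K.OrdConnected := by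
    refine fun c => hF.exists_interval _ ?_
    refine inter_mem (hI c) (inter_mem (eventually_forall_le hOF _)
      (inter_mem (eventually_forall_le (fun r => hMγ r c) _) ?_))
    refine (eventually_all_finite (Set.finite_Iic p)).2 fun i hi => ?_
    exact eventually_forall_le (fun r => eventually_forall_le (fun j => hlax i hi r j) c) _
  choose K hKF hKs hKo using hK
  refine ⟨γ, O, K, fun i t => if i = 0 then J t
      else C • (1 : Matrix ℕ ℕ ℂ) + circular p (Γ t) i, ⟨?_, ?_, ?_⟩, ?_, ?_, ?_, ?_, ?_⟩
  · exact hF.intervalSystem fun n => ⟨hOF n, hOo n⟩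
  · intro n hn t ht
    exact (hOs n ht hn).continuousAt.continuousWithinAt
  · intro n hn t ht
    have h := hOs n (ht n hn (by omega) (by omega)) hn
    refine HasDerivAt.congr_deriv h ?_
    rw [window_add_sub_window p (h0 t)]
  · exact fun c t ht => (hKs c ht).1
  · exact fun c n _ hn t ht => (hKs c ht).2.1 n hn
  · rfl
  · intro i hi1 hi
    simp only [if_neg (show i ≠ 0 by omega)]
    refine ⟨hF.intervalSystem fun n => ⟨hKF n, hKo n⟩, ?_, ?_, ?_, ?_, ?_⟩
    · intro r t _
      rw [Matrix.add_apply, circular_superdiag, Matrix.smul_apply, Matrix.one_apply_ne (by omega),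
        smul_zero, zero_add]
    · intro r c h t _
      rw [Matrix.add_apply, circular_eq_zero_of_upper p _ i h, Matrix.smul_apply,
        Matrix.one_apply_ne (by omega), smul_zero, zero_add]
    · intro r c h t _
      rw [Matrix.add_apply, circular_eq_zero_of_lower p _ i hi h, Matrix.smul_apply,
        Matrix.one_apply_ne (by omega), smul_zero, zero_add]
    · intro r c _ hr t ht
      exact (((hKs c ht).2.2.2 i hi r hr c le_rfl).continuousAt.const_add _).continuousWithinAt
    · intro r c t hr hc _
      have hd : HasDerivAt (fun s => circular p (Γ s) i r c)
          (laxRhs (diagWindow p (Γ t) i) (diagWindow p (Γ t) i) (circular p (Γ t) i) r c) t := by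
        rcases le_total r c with h | h
        · exact (hKs c hc).2.2.2 i hi r (by omega) c le_rfl
        · exact (hKs r hr).2.2.2 i hi r (by omega) c h
      refine (hd.const_add _).congr_deriv ?_
      have hdiag := fun r => circular_diag_eq_diagWindow p (g := Γ t) (h0 t) hi r
      simp only [laxRhs, ← hdiag, Matrix.add_apply, Matrix.smul_apply, smul_eq_mul]
      cases c with
      | zero =>
        rw [prev_zero, if_pos rfl, Matrix.one_apply_ne (show r + 1 ≠ 0 by omega)]
        by_cases h : r = 0
        · subst h; ring
        · rw [Matrix.one_apply_ne h, Matrix.one_apply_eq, Matrix.one_apply_eq]; ring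
      | succ c =>
        rw [prev_succ, if_neg (Nat.succ_ne_zero c), Nat.add_sub_cancel]
        have h1 : (1 : Matrix ℕ ℕ ℂ) (r + 1) (c + 1) = (1 : Matrix ℕ ℕ ℂ) r c := by
          simp [Matrix.one_apply]
        rw [h1]
        by_cases h : r = c + 1
        · subst h; ring
        · rw [Matrix.one_apply_ne h, Matrix.one_apply_eq, Matrix.one_apply_eq]; ring
  · intro i hi r c t ht
    by_cases h : i = 0
    · subst h
      simp only [if_true, Matrix.add_apply, Matrix.smul_apply, smul_eq_mul]
      by_cases hr : r ≤ c + p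
      · rw [← (hKs c ht).2.2.1 r hr, Matrix.one_apply]
        split_ifs <;> ring
      · rw [hJ.lower r c (by omega) t (hKs c ht).1,
          circular_eq_zero_of_lower p _ 0 hi (by omega), Matrix.one_apply_ne (by omega)]
        ring
    · simp only [if_neg h]
      rfl
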